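/- For a permutation $\pi=\pi_1\pi_2\cdots\pi_n\in\mathcal S_n$ and a pattern $\sigma\in\mathcal S_m$, say that $\pi$ is $\sigma$-avoiding if there are no indices $i_1<i_2<\dots<i_m$ such that $\pi_{i_1}\pi_{i_2}\cdots\pi_{i_m}$ is in the same relative order as $\sigma_1\sigma_2\cdots\sigma_m$, and let $\mathcal S_n(\sigma)$ be the set of $\sigma$-avoiding permutations in $\mathcal S_n$. Let $\mathrm{fp}(\pi)=|\{i:\pi_i=i\}|$ be the number of fixed points of $\pi$ and $\mathrm{exc}(\pi)=|\{i:\pi_i>i\}|$ its number of excedances. Theorem. For every $n\ge 0$ and all $0\le i,j\le n$, $$|\{\pi\in\mathcal S_n(321):\ \mathrm{fp}(\pi)=i,\ \mathrm{exc}(\pi)=j\}|=|\{\pi\in\mathcal S_n(132):\ \mathrm{fp}(\pi)=i,\ \mathrm{exc}(\pi)=j\}|.$$ Equivalently, for every $n\ge 0$, $$\sum_{\pi\in\mathcal S_n(321)}x^{\mathrm{fp}(\pi)}q^{\mathrm{exc}(\pi)}=\sum_{\pi\in\mathcal S_n(132)}x^{\mathrm{fp}(\pi)}q^{\mathrm{exc}(\pi)}$$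 as polynomials in the variables $x$ and $q$. -/

import Mathlib

/-- A permutation `π` of length `n` contains the pattern `σ` of length `m` if there are positions
`f 0 < f 1 < ⋯ < f (m - 1)` such that the entries of `π` at these positions are in the same
relative order as the entries of `σ`. Letters and positions are numbered from `0`. -/
def ContainsPattern {n m : ℕ} (π : Equiv.Perm (Fin n)) (σ : Equiv.Perm (Fin m)) : Prop :=
  ∃ f : Fin m → Fin n, (∀ a b : Fin m, a < b → f a < f b) ∧
    ∀ a b : Fin m, π (f a) < π (f b) ↔ σ a < σ b

instance {n m : ℕ} (π : Equiv.Perm (Fin n)) (σ : Equiv.Perm (Fin m)) :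
    Decidable (ContainsPattern π σ) := by
  unfold ContainsPattern; infer_instance

/-- The set of all `σ`-avoiding permutations of length `n`. -/
def avoiders (n : ℕ) {m : ℕ} (σ : Equiv.Perm (Fin m)) : Finset (Equiv.Perm (Fin n)) :=
  Finset.univ.filter fun π => ¬ ContainsPattern π σ

/-- The number of fixed points of a permutation. -/
def fp {n : ℕ} (π : Equiv.Perm (Fin n)) : ℕ :=
  (Finset.univ.filter fun i : Fin n => π i = i).card

/-- The number of excedances of a permutation. -/
def exc {n : ℕ} (π : Equiv.Perm (Fin n)) : ℕ :=
  (Finset.univ.filter fun i : Fin n => i < π i).card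

/-- The pattern 321: its one-line notation, numbered from `0`, is `2 1 0`. -/
def pattern321 : Equiv.Perm (Fin 3) := Equiv.swap 0 2

/-- The pattern 132: its one-line notation, numbered from `0`, is `0 2 1`. -/
def pattern132 : Equiv.Perm (Fin 3) := Equiv.swap 1 2

/-- The generating polynomial of `(fp, exc)` over the `σ`-avoiding permutations of length `n`,
in two variables `x` (index `0`) and `q` (index `1`). -/
noncomputable def genPoly (n : ℕ) {m : ℕ} (σ : Equiv.Perm (Fin m)) : MvPolynomial (Fin 2) ℤ :=
  ∑ π ∈ avoiders n σ, MvPolynomial.X 0 ^ fp π * MvPolynomial.X 1 ^ exc π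

/-! Over both classes the sum of `x ^ fp π * q ^ exc π` equals `motzkinWeight x q n 0`.

For 132, all entries left of the largest one exceed all entries right of it. Cutting there is the
first-return decomposition of Dyck paths, with `π i - i` as minus the centre of a tunnel and `k`
recording the shifts (`firstReturn_avoiders_132`). To reach Motzkin walks, consider chains of Dyck
paths with `2 * s` separating steps on the interval from `m - t` to `m + t`: their weights obey the
Motzkin recursion in `t` and `s` (`chainMatrix_eq_motzkinWeight`). Peeling off the left end of a
chain either uses up a separating step or opens a prime path, whose closing step becomes a new
separator. Such primes are centred left of the origin and weigh `q`; at the right end they weigh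
`1`. Only a prime filling the symmetric interval is centred at the origin, whence the `x` at height
`0`.

For 321, a permutation increases on its excedances and on the remaining positions, so the positions
and the values of its excedances determine it. Reading both sets from left to right gives a walk
whose height counts the excedances under way (`sum_avoiders_321`). A level step opens and closes a
line, or does neither, whence `1 + q`; at height `0` nothing can close, and doing neither marks a
fixed point. -/

/-- The total weight of the Motzkin walks with `t` steps from height `h` to height `0`, in which an
up step has weight `q`, a down step weight `1`, and a level step weight `x` at height `0` and
weight `1 + q` elsewhere. -/
def motzkinWeight {R : Type*} [CommRing R] (x q : R) : ℕ → ℕ → R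
  | 0, 0 => 1
  | 0, _ + 1 => 0
  | t + 1, 0 => x * motzkinWeight x q t 0 + q * motzkinWeight x q t 1
  | t + 1, h + 1 => motzkinWeight x q t h + (1 + q) * motzkinWeight x q t (h + 1) +
      q * motzkinWeight x q t (h + 2)

/-- The weight of an entry that exceeds its position by `d`. -/
def entryWeight {R : Type*} [CommRing R] (x q : R) (d : ℤ) : R :=
  if 0 < d then q else if d = 0 then x else 1

/-! ### Dyck paths with weighted tunnels -/

/-- The recursion of the total weights `C n k` of the Dyck paths of semilength `n` centred at `k`,
where a tunnel centred at `c` has weight `w (-c)`: decomposition at the first return. -/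
structure FirstReturn {R : Type*} [CommRing R] (w : ℤ → R) (C : ℕ → ℤ → R) : Prop where
  zero : ∀ k, C 0 k = 1
  succ : ∀ n k, C (n + 1) k = ∑ p ∈ Finset.range (n + 1),
    w ((n - p : ℕ) - k) * C p (k - (n - p : ℕ)) * C (n - p) (k + p + 1)

namespace FirstReturn

variable {R : Type*} [CommRing R]

/-- Entry `(a, e)` is the total weight of the Dyck paths that fill the interval from `a` to `e`,
with the origin at `m`. -/
def pathMatrix (C : ℕ → ℤ → R) (m : ℕ) : Matrix (Fin (2 * m + 1)) (Fin (2 * m + 1)) R :=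
  fun a e => if a ≤ e ∧ ((a : ℕ) + e) % 2 = 0 then
    C (((e : ℕ) - a) / 2) ((((a : ℕ) + e) / 2 : ℕ) - (m : ℤ)) else 0

/-- The matrix of a single step to the right. -/
def stepMatrix (R : Type*) [CommRing R] (m : ℕ) :
    Matrix (Fin (2 * m + 1)) (Fin (2 * m + 1)) R :=
  fun a e => if (a : ℕ) + 1 = e then 1 else 0

/-- Entry `(a, e)` is the total weight of the Dyck paths from `a` to `e` without intermediate
returns. -/
def primeMatrix (w : ℤ → R) (C : ℕ → ℤ → R) (m : ℕ) :
    Matrix (Fin (2 * m + 1)) (Fin (2 * m + 1)) R :=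
  fun a e => w (m - (((a : ℕ) + e) / 2 : ℕ)) *
    (stepMatrix R m * pathMatrix C m * stepMatrix R m) a e

/-- Entry `(a, e)` is the total weight of the sequences of `s + 1` Dyck paths that fill the interval
from `a` to `e`, consecutive paths being separated by a step. -/
def chainMatrix (C : ℕ → ℤ → R) (m s : ℕ) : Matrix (Fin (2 * m + 1)) (Fin (2 * m + 1)) R :=
  pathMatrix C m * (stepMatrix R m * pathMatrix C m) ^ s

lemma stepMatrix_mul {m : ℕ} (F : Matrix (Fin (2 * m + 1)) (Fin (2 * m + 1)) R)
    {a b e : Fin (2 * m + 1)} (h : (a : ℕ) + 1 = b) : (stepMatrix R m * F) a e = F b e := by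
  rw [Matrix.mul_apply, Finset.sum_eq_single b]
  · simp [stepMatrix, h]
  · intro c _ hc
    have : ¬ ((a : ℕ) + 1 = c) := fun h' => hc (Fin.ext (by omega))
    simp [stepMatrix, this]
  · simp

lemma mul_stepMatrix {m : ℕ} (F : Matrix (Fin (2 * m + 1)) (Fin (2 * m + 1)) R)
    {a b e : Fin (2 * m + 1)} (h : (b : ℕ) + 1 = e) : (F * stepMatrix R m) a e = F a b := by
  rw [Matrix.mul_apply, Finset.sum_eq_single b]
  · simp [stepMatrix, h]
  · intro c _ hc
    have : ¬ ((c : ℕ) + 1 = e) := fun h' => hc (Fin.ext (by omega))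
    simp [stepMatrix, this]
  · simp

lemma stepMatrix_mul_last {m : ℕ} (F : Matrix (Fin (2 * m + 1)) (Fin (2 * m + 1)) R)
    {a e : Fin (2 * m + 1)} (h : (a : ℕ) = 2 * m) : (stepMatrix R m * F) a e = 0 := by
  rw [Matrix.mul_apply, Finset.sum_eq_zero]
  intro c _
  have : ¬ ((a : ℕ) + 1 = c) := by have := c.2; omega
  simp [stepMatrix, this]

lemma mul_stepMatrix_zero {m : ℕ} (F : Matrix (Fin (2 * m + 1)) (Fin (2 * m + 1)) R)
    {a e : Fin (2 * m + 1)} (h : (e : ℕ) = 0) : (F * stepMatrix R m) a e = 0 := by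
  rw [Matrix.mul_apply, Finset.sum_eq_zero]
  intro c _
  have : ¬ ((c : ℕ) + 1 = e) := by omega
  simp [stepMatrix, this]

lemma pathMatrix_of_lt (C : ℕ → ℤ → R) {m : ℕ} {a e : Fin (2 * m + 1)} (h : e < a) :
    pathMatrix C m a e = 0 := by
  simp [pathMatrix, not_le.2 h]

lemma step_path_step_apply (C : ℕ → ℤ → R) {m : ℕ} (a e : Fin (2 * m + 1)) :
    (stepMatrix R m * pathMatrix C m * stepMatrix R m) a e =
      if (a : ℕ) + 2 ≤ e ∧ ((a : ℕ) + e) % 2 = 0 then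
        C (((e : ℕ) - a) / 2 - 1) ((((a : ℕ) + e) / 2 : ℕ) - (m : ℤ)) else 0 := by
  by_cases he : (e : ℕ) = 0
  · rw [mul_stepMatrix_zero _ he, if_neg (by omega)]
  rw [mul_stepMatrix (b := ⟨e - 1, by omega⟩) _ (by simp; omega)]
  by_cases ha : (a : ℕ) = 2 * m
  · rw [stepMatrix_mul_last _ ha, if_neg (by omega)]
  rw [stepMatrix_mul (b := ⟨a + 1, by omega⟩) _ (by simp), pathMatrix]
  by_cases h : (a : ℕ) + 2 ≤ e ∧ ((a : ℕ) + e) % 2 = 0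
  · rw [if_pos h, if_pos (by simp only [Fin.mk_le_mk]; omega)]
    congr 3
    · simp only; omega
    · simp only; omega
  · rw [if_neg h, if_neg (by simp only [Fin.mk_le_mk]; omega)]

/-- The separating steps alone take up length `s`. This bounds the centres of the primes at the ends
of a chain. -/
lemma chainMatrix_of_lt (C : ℕ → ℤ → R) {m : ℕ} (s : ℕ) {a e : Fin (2 * m + 1)}
    (h : (e : ℕ) < a + s) : chainMatrix C m s a e = 0 := by
  induction s generalizing e with
  | zero => simpa [chainMatrix] using pathMatrix_of_lt C h
  | succ s ih =>
    rw [chainMatrix, pow_succ, ← Matrix.mul_assoc, Matrix.mul_apply]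
    refine Finset.sum_eq_zero fun b _ => ?_
    by_cases hb : (b : ℕ) < a + s
    · rw [← chainMatrix, ih hb, zero_mul]
    · by_cases hl : (b : ℕ) = 2 * m
      · rw [stepMatrix_mul_last _ hl, mul_zero]
      · rw [stepMatrix_mul (b := ⟨b + 1, by omega⟩) _ rfl,
          pathMatrix_of_lt _ (Fin.lt_def.2 (by change (e : ℕ) < b + 1; omega)), mul_zero]

variable {w : ℤ → R} {C : ℕ → ℤ → R}

lemma pathMatrix_eq (hC : FirstReturn w C) (m : ℕ) :
    pathMatrix C m = 1 + primeMatrix w C m * pathMatrix C m := by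
  ext a e
  rw [Matrix.add_apply, Matrix.mul_apply]
  by_cases hae : a = e
  · subst hae
    rw [Matrix.one_apply_eq, Finset.sum_eq_zero, add_zero]
    · have : ((a : ℕ) + a) % 2 = 0 := by omega
      simp [pathMatrix, this, hC.zero]
    · intro b _
      rw [primeMatrix, step_path_step_apply]
      by_cases h : (a : ℕ) + 2 ≤ b
      · rw [pathMatrix_of_lt C (Fin.lt_def.2 (by omega)), mul_zero]
      · rw [if_neg (by omega)]; simp
  rw [Matrix.one_apply_ne hae, zero_add]
  by_cases h : a ≤ e ∧ ((a : ℕ) + e) % 2 = 0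
  swap
  · rw [pathMatrix, if_neg h, eq_comm]
    refine Finset.sum_eq_zero fun b _ => ?_
    rw [primeMatrix, step_path_step_apply, pathMatrix]
    by_cases h1 : (a : ℕ) + 2 ≤ b ∧ ((a : ℕ) + b) % 2 = 0
    · rw [if_neg (c := b ≤ e ∧ _), mul_zero]
      rw [Fin.le_def] at h ⊢; omega
    · rw [if_neg h1]; simp
  obtain ⟨n, hn⟩ : ∃ n, (e : ℕ) = a + 2 * (n + 1) := by
    have : (a : ℕ) ≠ e := fun h' => hae (Fin.ext h')
    have := Fin.le_def.1 h.1
    exact ⟨((e : ℕ) - a) / 2 - 1, by omega⟩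
  have hK : pathMatrix C m a e = C (n + 1) ((a : ℤ) + n + 1 - m) := by
    rw [pathMatrix, if_pos h]; congr 1 <;> omega
  rw [hK, hC.succ]
  -- The prime with interior of semilength `p` returns at `a + 2 * (p + 1)`; the value `0` outside
  -- the range is never used.
  refine Finset.sum_of_injOn
    (fun p => if hp : p ≤ n then (⟨a + 2 * (p + 1), by omega⟩ : Fin (2 * m + 1)) else 0)
    ?_ (by simp [Set.MapsTo]) ?_ ?_
  · intro p hp p' hp' hpp
    simp only [Finset.coe_range, Set.mem_Iio] at hp hp'
    simp only [dif_pos (Nat.lt_succ_iff.1 hp), dif_pos (Nat.lt_succ_iff.1 hp'),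
      Fin.mk.injEq] at hpp
    omega
  · intro b _ hb
    rw [primeMatrix, step_path_step_apply]
    by_cases h1 : (a : ℕ) + 2 ≤ b ∧ ((a : ℕ) + b) % 2 = 0
    · rw [pathMatrix_of_lt, mul_zero]
      by_contra hbe
      refine hb ⟨((b : ℕ) - a) / 2 - 1, ?_, ?_⟩
      · rw [Fin.lt_def] at hbe; simp; omega
      · rw [Fin.lt_def] at hbe
        simp only [dif_pos (show ((b : ℕ) - a) / 2 - 1 ≤ n by omega)]
        ext; simp only; omega
    · rw [if_neg h1]; simp
  · intro p hp
    have hp' : p ≤ n := Nat.lt_succ_iff.1 (Finset.mem_range.1 hp)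
    simp only [dif_pos hp']
    rw [primeMatrix, step_path_step_apply, pathMatrix, if_pos (by simp only; omega),
      if_pos (by rw [Fin.le_def]; simp only; omega)]
    congr 1
    · congr 2 <;> (try simp only) <;> omega
    · congr 1 <;> (try simp only) <;> omega

/-- Decomposition at the last return, obtained for free: a one-sided inverse of a square matrix is
two-sided. -/
lemma pathMatrix_eq' (hC : FirstReturn w C) (m : ℕ) :
    pathMatrix C m = 1 + pathMatrix C m * primeMatrix w C m := by
  have h : (1 - primeMatrix w C m) * pathMatrix C m = 1 := by
    rw [sub_mul, one_mul, sub_eq_iff_eq_add]; exact hC.pathMatrix_eq m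
  rw [mul_eq_one_comm, mul_sub, mul_one, sub_eq_iff_eq_add] at h
  exact h

lemma chainMatrix_eq_left (C : ℕ → ℤ → R) (m s : ℕ) :
    chainMatrix C m s = (pathMatrix C m * stepMatrix R m) ^ s * pathMatrix C m := by
  induction s with
  | zero => simp [chainMatrix]
  | succ s ih =>
    rw [pow_succ, chainMatrix, pow_succ, ← mul_assoc (pathMatrix C m), ← chainMatrix, ih]
    simp only [mul_assoc]

/-- The leading path is either empty, so that the chain begins with a separating step, or begins
with a prime. -/
lemma chainMatrix_succ (hC : FirstReturn w C) (m s : ℕ) :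
    chainMatrix C m (s + 1) =
      stepMatrix R m * chainMatrix C m s + primeMatrix w C m * chainMatrix C m (s + 1) := by
  have h1 : stepMatrix R m * chainMatrix C m s = (stepMatrix R m * pathMatrix C m) ^ (s + 1) := by
    rw [chainMatrix, pow_succ', mul_assoc]
  rw [h1, chainMatrix, ← mul_assoc (primeMatrix w C m)]
  conv_lhs => rw [hC.pathMatrix_eq m, add_mul, one_mul]
  -- The unfolding hit every factor `pathMatrix C m`; the inner ones are folded back.
  rw [← hC.pathMatrix_eq m]

lemma chainMatrix_succ' (hC : FirstReturn w C) (m s : ℕ) :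
    chainMatrix C m (s + 1) =
      chainMatrix C m s * stepMatrix R m + chainMatrix C m (s + 1) * primeMatrix w C m := by
  have h1 : chainMatrix C m s * stepMatrix R m = (pathMatrix C m * stepMatrix R m) ^ (s + 1) := by
    rw [chainMatrix_eq_left, pow_succ, mul_assoc]
  have h2 := hC.pathMatrix_eq' m
  rw [h1, chainMatrix_eq_left, mul_assoc _ (pathMatrix C m)]
  exact (congrArg _ h2).trans (mul_one_add _ _)

/-- Once all contributing primes have the same weight, it factors out, and the two outer steps of
the prime become ordinary steps that can serve as separators. -/
lemma prime_mul_apply {m : ℕ} {y : R} (F : Matrix (Fin (2 * m + 1)) (Fin (2 * m + 1)) R)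
    {a e : Fin (2 * m + 1)}
    (hF : ∀ b : Fin (2 * m + 1), F b e ≠ 0 → ((a : ℕ) + b) % 2 = 0 →
      w (m - (((a : ℕ) + b) / 2 : ℕ)) = y) :
    (primeMatrix w C m * F) a e =
      y * (stepMatrix R m * pathMatrix C m * stepMatrix R m * F) a e := by
  rw [Matrix.mul_apply, Matrix.mul_apply, Finset.mul_sum]
  refine Finset.sum_congr rfl fun b _ => ?_
  by_cases hb : F b e = 0
  · simp [hb]
  by_cases hp : ((a : ℕ) + b) % 2 = 0
  · rw [primeMatrix, hF b hb hp, mul_assoc]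
  · rw [primeMatrix, step_path_step_apply, if_neg (by omega)]; simp

lemma mul_prime_apply {m : ℕ} {y : R} (F : Matrix (Fin (2 * m + 1)) (Fin (2 * m + 1)) R)
    {a e : Fin (2 * m + 1)}
    (hF : ∀ b : Fin (2 * m + 1), F a b ≠ 0 → ((b : ℕ) + e) % 2 = 0 →
      w (m - (((b : ℕ) + e) / 2 : ℕ)) = y) :
    (F * primeMatrix w C m) a e =
      y * (F * (stepMatrix R m * pathMatrix C m * stepMatrix R m)) a e := by
  rw [Matrix.mul_apply, Matrix.mul_apply, Finset.mul_sum]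
  refine Finset.sum_congr rfl fun b _ => ?_
  by_cases hb : F a b = 0
  · simp [hb]
  by_cases hp : ((b : ℕ) + e) % 2 = 0
  · rw [primeMatrix, hF b hb hp]; ring
  · rw [primeMatrix, step_path_step_apply, if_neg (by omega)]; simp

variable {x q : R}

/-- At least one separating step follows the first path, so a prime starting at `a` ends before `e`
and is centred left of the origin. -/
lemma chainMatrix_peel_left (hC : FirstReturn (entryWeight x q) C) {m s : ℕ}
    {a b e : Fin (2 * m + 1)} (hab : (a : ℕ) + 1 = b) (h : (a : ℕ) + e ≤ 2 * m) :
    chainMatrix C m (s + 1) a e = chainMatrix C m s b e + q * chainMatrix C m (s + 2) b e := by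
  rw [hC.chainMatrix_succ, Matrix.add_apply, stepMatrix_mul _ hab, prime_mul_apply (y := q)]
  · rw [← stepMatrix_mul (chainMatrix C m (s + 2)) hab]
    simp only [chainMatrix, pow_succ' _ (s + 1), mul_assoc]
  · intro c hc hp
    have : ¬ ((e : ℕ) < c + (s + 1)) := fun h' => hc (chainMatrix_of_lt C _ h')
    rw [entryWeight, if_pos (by omega)]

lemma chainMatrix_peel_right (hC : FirstReturn (entryWeight x q) C) {m s : ℕ}
    {a b e : Fin (2 * m + 1)} (hbe : (b : ℕ) + 1 = e) (h : 2 * m ≤ (a : ℕ) + e) :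
    chainMatrix C m (s + 1) a e = chainMatrix C m s a b + chainMatrix C m (s + 2) a b := by
  rw [hC.chainMatrix_succ', Matrix.add_apply, mul_stepMatrix _ hbe, mul_prime_apply (y := 1)]
  · rw [one_mul, ← mul_stepMatrix (chainMatrix C m (s + 2)) hbe]
    simp only [chainMatrix, pow_succ _ (s + 1), mul_assoc]
  · intro c hc hp
    have : ¬ ((c : ℕ) < a + (s + 1)) := fun h' => hc (chainMatrix_of_lt C _ h')
    rw [entryWeight, if_neg (by omega), if_neg (by omega)]

/-- Without separating steps a prime may reach `e`; it is then centred at the origin, and `x - q`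
corrects its weight. -/
lemma pathMatrix_peel_left (hC : FirstReturn (entryWeight x q) C) {m : ℕ}
    {a b d e : Fin (2 * m + 1)} (hab : (a : ℕ) + 1 = b) (hde : (d : ℕ) + 1 = e) (hae : a ≠ e)
    (h : (a : ℕ) + e = 2 * m) :
    pathMatrix C m a e = q * chainMatrix C m 1 b e + (x - q) * pathMatrix C m b d := by
  have h1 : chainMatrix C m 1 b e =
      (stepMatrix R m * pathMatrix C m * stepMatrix R m * pathMatrix C m) a e := by
    rw [← stepMatrix_mul (chainMatrix C m 1) hab]; simp only [chainMatrix, pow_one, mul_assoc]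
  have h2 : pathMatrix C m b d = (stepMatrix R m * pathMatrix C m * stepMatrix R m) a e := by
    rw [mul_stepMatrix _ hde, stepMatrix_mul _ hab]
  have h3 : pathMatrix C m e e = 1 := by
    have : ((e : ℕ) + e) % 2 = 0 := by omega
    simp [pathMatrix, this, hC.zero]
  rw [h1, h2, hC.pathMatrix_eq m, Matrix.add_apply, Matrix.one_apply_ne hae, zero_add,
    ← hC.pathMatrix_eq m, Matrix.mul_apply, Matrix.mul_apply,
    ← Finset.add_sum_erase _ _ (Finset.mem_univ e),
    ← Finset.add_sum_erase _ _ (Finset.mem_univ e), h3, mul_add, Finset.mul_sum, primeMatrix,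
    entryWeight, if_neg (by omega), if_pos (by omega)]
  have : ∀ c ∈ Finset.univ.erase e,
      primeMatrix (entryWeight x q) C m a c * pathMatrix C m c e =
      q * ((stepMatrix R m * pathMatrix C m * stepMatrix R m) a c * pathMatrix C m c e) := by
    intro c hc
    have hce : (c : ℕ) ≠ e := fun h' => (Finset.mem_erase.1 hc).1 (Fin.ext h')
    rcases lt_or_ge e c with hlt | hle
    · simp [pathMatrix_of_lt C hlt]
    · rw [Fin.le_def] at hle
      by_cases hp : ((a : ℕ) + c) % 2 = 0
      · rw [primeMatrix, entryWeight, if_pos (by omega), mul_assoc]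
      · rw [primeMatrix, step_path_step_apply, if_neg (by omega)]; simp
  rw [Finset.sum_congr rfl this]
  ring

theorem chainMatrix_eq_motzkinWeight (hC : FirstReturn (entryWeight x q) C) {m t : ℕ} (s : ℕ)
    (ht : t ≤ m) :
    chainMatrix C m (2 * s) ⟨m - t, by omega⟩ ⟨m + t, by omega⟩ = motzkinWeight x q t s := by
  induction t generalizing s with
  | zero =>
    cases s with
    | zero =>
      have : (m + m) % 2 = 0 := by omega
      simp [chainMatrix, pathMatrix, this, hC.zero, motzkinWeight]
    | succ s => rw [chainMatrix_of_lt _ _ (by simp only; omega), motzkinWeight]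
  | succ t ih =>
    have ih' := fun s => ih s (by omega)
    have hr : ∀ s, chainMatrix C m (2 * s + 1) ⟨m - t, by omega⟩ ⟨m + (t + 1), by omega⟩ =
        motzkinWeight x q t s + motzkinWeight x q t (s + 1) := by
      intro s
      rw [hC.chainMatrix_peel_right (b := ⟨m + t, by omega⟩) (by simp only; omega)
        (by simp only; omega), ih', ← ih' (s + 1)]
      rfl
    cases s with
    | zero =>
      have h0 := ih' 0
      have hr0 := hr 0
      simp only [mul_zero, zero_add] at hr0
      simp only [chainMatrix, mul_zero, pow_zero, mul_one] at h0 ⊢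
      rw [hC.pathMatrix_peel_left (b := ⟨m - t, by omega⟩) (d := ⟨m + t, by omega⟩)
        (by simp only; omega) (by simp only; omega) (by simp only [ne_eq, Fin.mk.injEq]; omega)
        (by simp only; omega), h0, hr0, motzkinWeight]
      ring
    | succ s =>
      rw [show 2 * (s + 1) = 2 * s + 1 + 1 by ring,
        hC.chainMatrix_peel_left (b := ⟨m - t, by omega⟩) (by simp only; omega)
        (by simp only; omega), hr, show 2 * s + 1 + 2 = 2 * (s + 1) + 1 by ring, hr, motzkinWeight]
      ring

theorem eq_motzkinWeight (hC : FirstReturn (entryWeight x q) C) (n : ℕ) :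
    C n 0 = motzkinWeight x q n 0 := by
  rw [← hC.chainMatrix_eq_motzkinWeight 0 le_rfl]
  have : (n - n + (n + n)) % 2 = 0 := by omega
  simp only [chainMatrix, mul_zero, pow_zero, mul_one, pathMatrix]
  rw [if_pos (by rw [Fin.le_def]; simp only; omega)]
  congr 1 <;> omega

end FirstReturn

/-! ### The two patterns in terms of three positions -/

lemma containsPattern_of_fin_three {n : ℕ} {π : Equiv.Perm (Fin n)} {σ : Equiv.Perm (Fin 3)}
    {a b c : Fin n} (hab : a < b) (hbc : b < c)
    (h : ∀ i j : Fin 3, π (![a, b, c] i) < π (![a, b, c] j) ↔ σ i < σ j) :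
    ContainsPattern π σ := by
  refine ⟨![a, b, c], ?_, h⟩
  intro i j hij
  fin_cases i <;> fin_cases j <;> simp_all [lt_trans hab hbc]

lemma mem_avoiders_132 {n : ℕ} {π : Equiv.Perm (Fin n)} :
    π ∈ avoiders n pattern132 ↔
      ∀ a b c : Fin n, a < b → b < c → π a < π c → ¬ π c < π b := by
  simp only [avoiders, Finset.mem_filter, Finset.mem_univ, true_and]
  constructor
  · intro h a b c hab hbc hac hcb
    refine h (containsPattern_of_fin_three hab hbc ?_)
    intro i j
    have hab' := hac.trans hcb
    fin_cases i <;> fin_cases j <;>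
      simp [pattern132, Equiv.swap_apply_def, hac, hcb, hab', hac.le, hcb.le, hab'.le]
  · rintro h ⟨f, hf, hσ⟩
    refine h (f 0) (f 1) (f 2) (hf _ _ (by decide)) (hf _ _ (by decide))
      ((hσ _ _).2 (by decide)) ((hσ _ _).2 (by decide))

lemma mem_avoiders_321 {n : ℕ} {π : Equiv.Perm (Fin n)} :
    π ∈ avoiders n pattern321 ↔
      ∀ a b c : Fin n, a < b → b < c → π c < π b → ¬ π b < π a := by
  simp only [avoiders, Finset.mem_filter, Finset.mem_univ, true_and]
  constructor
  · intro h a b c hab hbc hcb hba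
    refine h (containsPattern_of_fin_three hab hbc ?_)
    intro i j
    have hca := hcb.trans hba
    fin_cases i <;> fin_cases j <;>
      simp [pattern321, Equiv.swap_apply_def, hca, hcb, hba, hca.le, hcb.le, hba.le]
  · rintro h ⟨f, hf, hσ⟩
    refine h (f 0) (f 1) (f 2) (hf _ _ (by decide)) (hf _ _ (by decide))
      ((hσ _ _).2 (by decide)) ((hσ _ _).2 (by decide))

/-! ### 132-avoiding permutations: decomposition at the largest entry -/

/-- The permutation whose entries are those of `L`, increased by the length of `R`, followed by the
largest entry and by those of `R`. -/
noncomputable def glueAtMax {n : ℕ} (p : Fin (n + 1)) (L : Equiv.Perm (Fin p))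
    (R : Equiv.Perm (Fin (n - p))) : Equiv.Perm (Fin (n + 1)) :=
  Equiv.ofBijective
    (fun i => if h : (i : ℕ) < p then ⟨(n - p) + L ⟨i, h⟩, by omega⟩
      else if h' : (i : ℕ) = p then Fin.last n
      else ⟨R ⟨i - p - 1, by omega⟩, by omega⟩)
    (Finite.injective_iff_bijective.1 (by
      intro i j hij
      simp only at hij
      have hL := fun (h : (i : ℕ) < p) (h' : (j : ℕ) < p) =>
        L.injective.ne_iff (x := ⟨i, h⟩) (y := ⟨j, h'⟩)
      have hR := fun (h : (i : ℕ) - p - 1 < n - p) (h' : (j : ℕ) - p - 1 < n - p) =>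
        R.injective.ne_iff (x := ⟨i - p - 1, h⟩) (y := ⟨j - p - 1, h'⟩)
      simp only [ne_eq, Fin.ext_iff] at hL hR
      split_ifs at hij <;> simp only [Fin.ext_iff, Fin.val_last] at hij <;> ext
      · have := hL ‹_› ‹_›; omega
      · omega
      · omega
      · omega
      · omega
      · omega
      · omega
      · omega
      · have := hR (by omega) (by omega); omega))

lemma glueAtMax_left {n : ℕ} {p : Fin (n + 1)} (L : Equiv.Perm (Fin p))
    (R : Equiv.Perm (Fin (n - p))) {i : Fin (n + 1)} (h : (i : ℕ) < p) :
    (glueAtMax p L R i : ℕ) = (n - p) + L ⟨i, h⟩ := by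
  rw [glueAtMax, Equiv.ofBijective_apply, dif_pos h]

lemma glueAtMax_max {n : ℕ} {p : Fin (n + 1)} (L : Equiv.Perm (Fin p))
    (R : Equiv.Perm (Fin (n - p))) {i : Fin (n + 1)} (h : (i : ℕ) = p) :
    (glueAtMax p L R i : ℕ) = n := by
  rw [glueAtMax, Equiv.ofBijective_apply, dif_neg h.not_lt, dif_pos h, Fin.val_last]

lemma glueAtMax_right {n : ℕ} {p : Fin (n + 1)} (L : Equiv.Perm (Fin p))
    (R : Equiv.Perm (Fin (n - p))) {i : Fin (n + 1)} (h : (p : ℕ) < i) :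
    (glueAtMax p L R i : ℕ) = R ⟨i - p - 1, by omega⟩ := by
  rw [glueAtMax, Equiv.ofBijective_apply, dif_neg h.not_gt, dif_neg h.ne']

lemma glueAtMax_mem {n : ℕ} {p : Fin (n + 1)} {L : Equiv.Perm (Fin p)}
    {R : Equiv.Perm (Fin (n - p))} (hL : L ∈ avoiders p pattern132)
    (hR : R ∈ avoiders (n - p) pattern132) :
    glueAtMax p L R ∈ avoiders (n + 1) pattern132 := by
  rw [mem_avoiders_132] at *
  intro a b c hab hbc hac hcb
  simp only [Fin.lt_def] at *
  rcases lt_trichotomy (c : ℕ) p with hc | hc | hc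
  · rw [glueAtMax_left L R (i := a) (by omega), glueAtMax_left L R hc] at hac
    rw [glueAtMax_left L R (i := b) (by omega), glueAtMax_left L R hc] at hcb
    exact hL ⟨a, by omega⟩ ⟨b, by omega⟩ ⟨c, by omega⟩ hab hbc (by omega) (by omega)
  · rw [glueAtMax_max L R hc] at hcb
    omega
  · have hc' := glueAtMax_right L R hc
    rcases lt_trichotomy (a : ℕ) p with ha | ha | ha
    · rw [glueAtMax_left L R ha] at hac
      omega
    · rw [glueAtMax_max L R ha] at hac
      omega
    · rw [glueAtMax_right L R ha, hc'] at hac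
      rw [glueAtMax_right L R (i := b) (by omega), hc'] at hcb
      exact hR ⟨a - p - 1, by omega⟩ ⟨b - p - 1, by omega⟩ ⟨c - p - 1, by omega⟩
        (by simp only; omega) (by simp only; omega) hac hcb

lemma eq_of_glueAtMax_eq {n : ℕ} {p : Fin (n + 1)} {L L' : Equiv.Perm (Fin p)}
    {R R' : Equiv.Perm (Fin (n - p))} (h : glueAtMax p L R = glueAtMax p L' R') :
    L = L' ∧ R = R' := by
  constructor
  · ext i
    have h1 := glueAtMax_left L R (i := ⟨i, by omega⟩) i.2
    rw [h, glueAtMax_left L' R' i.2] at h1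
    simp only [Fin.eta] at h1
    omega
  · ext i
    have hi : (p : ℕ) < (⟨p + 1 + i, by omega⟩ : Fin (n + 1)) := by simp only; omega
    have h1 := glueAtMax_right L R hi
    rw [h, glueAtMax_right L' R' hi] at h1
    have : (⟨p + 1 + i - p - 1, by omega⟩ : Fin (n - p)) = i := by ext; simp only; omega
    simpa only [this] using h1.symm

lemma exists_glueAtMax_eq {n : ℕ} {π : Equiv.Perm (Fin (n + 1))}
    (hπ : π ∈ avoiders (n + 1) pattern132) :
    ∃ (p : Fin (n + 1)) (L : Equiv.Perm (Fin p)) (R : Equiv.Perm (Fin (n - p))),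
      L ∈ avoiders p pattern132 ∧ R ∈ avoiders (n - p) pattern132 ∧ glueAtMax p L R = π := by
  rw [mem_avoiders_132] at hπ
  set p := π.symm (Fin.last n) with hp
  have hpn : π p = Fin.last n := by simp [hp]
  have hlast : ∀ i, i ≠ p → (π i : ℕ) < n := by
    intro i hi
    have : π i ≠ Fin.last n := fun h => hi (π.injective (h.trans hpn.symm))
    rw [ne_eq, Fin.ext_iff, Fin.val_last] at this
    omega
  have hlt : ∀ i j, i < p → p < j → π j < π i := by
    intro i j hi hj
    refine lt_of_le_of_ne (not_lt.1 fun h => hπ i p j hi hj h ?_)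
      (π.injective.ne (hi.trans hj).ne')
    rw [hpn, Fin.lt_def]
    exact hlast j hj.ne'
  have hright : ∀ j, p < j → (π j : ℕ) < n - p := by
    intro j hj
    -- All values up to `π j` occur to the right of `p`, where only `n - p` positions are available.
    have hsub : (Finset.Iic (π j)).map π.symm.toEmbedding ⊆ Finset.Ioi p := by
      intro i hi
      simp only [Finset.mem_map, Finset.mem_Iic, Equiv.coe_toEmbedding, Finset.mem_Ioi] at hi ⊢
      obtain ⟨v, hv, rfl⟩ := hi
      by_contra hle
      rcases (not_lt.1 hle).lt_or_eq with h | h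
      · have := hlt _ _ h hj
        rw [Equiv.apply_symm_apply] at this
        exact absurd hv (not_le.2 this)
      · have h2 := hlast j hj.ne'
        have h3 : v = Fin.last n := by rw [← hpn, ← h, Equiv.apply_symm_apply]
        rw [h3, Fin.le_def, Fin.val_last] at hv
        omega
    have := Finset.card_le_card hsub
    rw [Finset.card_map, Fin.card_Iic, Fin.card_Ioi] at this
    omega
  have hleft : ∀ i, i < p → n - p ≤ (π i : ℕ) := by
    intro i hi
    have hsub : (Finset.Ioi p).map π.toEmbedding ⊆ Finset.Iio (π i) := by
      intro v hv
      simp only [Finset.mem_map, Finset.mem_Ioi, Equiv.coe_toEmbedding, Finset.mem_Iio] at hv ⊢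
      obtain ⟨j, hj, rfl⟩ := hv
      exact hlt i j hi hj
    have := Finset.card_le_card hsub
    rw [Finset.card_map, Fin.card_Iio, Fin.card_Ioi] at this
    omega
  have hinj : ∀ i j, (π i : ℕ) = π j → (i : ℕ) = j := fun i j h =>
    congrArg Fin.val (π.injective (Fin.ext h))
  let L : Equiv.Perm (Fin p) := Equiv.ofBijective
    (fun i => ⟨π ⟨i, by omega⟩ - (n - p), by
      have h1 := hleft ⟨i, by omega⟩ (Fin.lt_def.2 i.2)
      have h2 := hlast ⟨i, by omega⟩ (Fin.lt_def.2 i.2).ne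
      omega⟩)
    (Finite.injective_iff_bijective.1 (by
      intro i j hij
      have h1 := hleft ⟨i, by omega⟩ (Fin.lt_def.2 i.2)
      have h2 := hleft ⟨j, by omega⟩ (Fin.lt_def.2 j.2)
      simp only [Fin.mk.injEq] at hij
      exact Fin.ext (hinj ⟨i, by omega⟩ ⟨j, by omega⟩ (by omega))))
  let R : Equiv.Perm (Fin (n - p)) := Equiv.ofBijective
    (fun i => ⟨π ⟨p + 1 + i, by omega⟩, hright _ (Fin.lt_def.2 (by simp only; omega))⟩)
    (Finite.injective_iff_bijective.1 (by
      intro i j hij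
      simp only [Fin.mk.injEq] at hij
      have := hinj _ _ hij
      simp only at this
      exact Fin.ext (by omega)))
  have hLv : ∀ i : Fin p, (L i : ℕ) = π ⟨i, by omega⟩ - (n - p) := fun _ => rfl
  have hRv : ∀ i : Fin (n - p), (R i : ℕ) = π ⟨p + 1 + i, by omega⟩ := fun _ => rfl
  refine ⟨p, L, R, ?_, ?_, ?_⟩
  · rw [mem_avoiders_132]
    intro a b c hab hbc hac hcb
    rw [Fin.lt_def, hLv, hLv] at hac hcb
    exact hπ ⟨a, by omega⟩ ⟨b, by omega⟩ ⟨c, by omega⟩ hab hbc (by rw [Fin.lt_def]; omega)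
      (by rw [Fin.lt_def]; omega)
  · rw [mem_avoiders_132]
    intro a b c hab hbc hac hcb
    rw [Fin.lt_def, hRv, hRv] at hac hcb
    exact hπ ⟨p + 1 + a, by omega⟩ ⟨p + 1 + b, by omega⟩ ⟨p + 1 + c, by omega⟩
      (Fin.lt_def.2 (Nat.add_lt_add_left hab _)) (Fin.lt_def.2 (Nat.add_lt_add_left hbc _))
      hac hcb
  · ext i
    rcases lt_trichotomy i p with hi | hi | hi
    · rw [glueAtMax_left L R hi, hLv]
      exact Nat.add_sub_cancel' (hleft i hi)
    · rw [glueAtMax_max L R (congrArg _ hi), hi, hpn, Fin.val_last]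
    · rw [glueAtMax_right L R hi, hRv]
      congr 3
      have := Fin.lt_def.1 hi
      simp only; omega

lemma prod_glueAtMax {M : Type*} [CommMonoid M] {n : ℕ} {p : Fin (n + 1)}
    (L : Equiv.Perm (Fin p)) (R : Equiv.Perm (Fin (n - p))) (f : ℕ → ℕ → M) :
    ∏ i, f (glueAtMax p L R i) i =
      (∏ i, f ((n - p) + L i) i) * f n p * ∏ i, f (R i) (p + 1 + i) := by
  have hn : (p : ℕ) + 1 + (n - p) = n + 1 := by omega
  rw [← Fin.prod_congr' _ hn, Fin.prod_univ_add, Fin.prod_univ_castSucc]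
  congr 1
  · congr 1
    · refine Finset.prod_congr rfl fun i _ => ?_
      rw [glueAtMax_left L R (by simp)]
      rfl
    · rw [glueAtMax_max L R (by simp)]
      simp
  · refine Finset.prod_congr rfl fun i _ => ?_
    rw [glueAtMax_right L R (by simp; omega)]
    congr 3
    refine Fin.ext ?_
    change (p : ℕ) + 1 + i - p - 1 = i
    omega

/-- With the largest entry at `p`, its excess is `n - p`. On the left, values rise by `n - p`; on
the right, positions rise by `p + 1`. These are the shifts of `k` in the recursion. -/
theorem firstReturn_avoiders_132 {R : Type*} [CommRing R] (w : ℤ → R) :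
    FirstReturn w fun n k => ∑ π ∈ avoiders n pattern132, ∏ i, w ((π i : ℕ) - (i : ℕ) - k) where
  zero k := by
    have : avoiders 0 pattern132 = Finset.univ := by
      ext π
      simp only [mem_avoiders_132, Finset.mem_univ, iff_true]
      exact fun a => a.elim0
    simp [this]
  succ n k := by
    have h : ∀ p : Fin (n + 1),
        w ((n - p : ℕ) - k) *
          (∑ π ∈ avoiders p pattern132, ∏ i, w ((π i : ℕ) - (i : ℕ) - (k - (n - p : ℕ)))) *
          (∑ π ∈ avoiders (n - p) pattern132, ∏ i, w ((π i : ℕ) - (i : ℕ) - (k + p + 1))) =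
        ∑ LR ∈ avoiders p pattern132 ×ˢ avoiders (n - p) pattern132,
          ∏ i, w ((glueAtMax p LR.1 LR.2 i : ℕ) - (i : ℕ) - k) := by
      intro p
      rw [mul_assoc, Finset.sum_mul_sum, ← Finset.sum_product', Finset.mul_sum]
      refine Finset.sum_congr rfl fun LR _ => ?_
      rw [prod_glueAtMax LR.1 LR.2 fun v i => w (v - i - k), mul_left_comm, ← mul_assoc]
      congr 1
      · congr 1
        · refine Finset.prod_congr rfl fun i _ => ?_
          congr 1; push_cast; ring
        · congr 1; have := p.2; omega
      · refine Finset.prod_congr rfl fun i _ => ?_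
        congr 1; push_cast; ring
    rw [Finset.sum_range, Finset.sum_congr rfl fun p _ => h p, Finset.sum_sigma']
    symm
    refine Finset.sum_bij (fun x _ => glueAtMax x.1 x.2.1 x.2.2) ?_ ?_ ?_ fun _ _ => rfl
    · rintro ⟨p, L, R⟩ hx
      simp only [Finset.mem_sigma, Finset.mem_univ, Finset.mem_product, true_and] at hx
      exact glueAtMax_mem hx.1 hx.2
    · rintro ⟨p, L, R⟩ _ ⟨p', L', R'⟩ _ h
      simp only at h
      have hp : p = p' := by
        have h1 := glueAtMax_max L R rfl
        have h2 := glueAtMax_max L' R' rfl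
        rw [h] at h1
        exact (glueAtMax p' L' R').injective (Fin.ext (h1.trans h2.symm))
      subst hp
      obtain ⟨rfl, rfl⟩ := eq_of_glueAtMax_eq h
      rfl
    · intro π hπ
      obtain ⟨p, L, R, hL, hR, h⟩ := exists_glueAtMax_eq hπ
      exact ⟨⟨p, L, R⟩, by simp [hL, hR], h⟩

/-! ### Motzkin walks with coloured level steps -/

section Walks

variable {R : Type*} [CommRing R] {n : ℕ}

/-- The height gained in a step: the components of `c` tell whether a line opens and whether a
line closes. -/
def stepHeight (c : Bool × Bool) : ℤ := (if c.1 then 1 else 0) - (if c.2 then 1 else 0)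

/-- The weight of a step that starts at height `z`. -/
def stepWeight (x q : R) (z : ℤ) (c : Bool × Bool) : R :=
  (if c.1 then q else 1) * (if c.2 ∧ z ≤ 0 then 0 else 1) *
    (if ¬ c.1 ∧ ¬ c.2 ∧ z = 0 then x else 1)

/-- The height gained before step `t`. -/
def heightBefore (c : Fin n → Bool × Bool) (t : Fin n) : ℤ :=
  ∑ s, if s < t then stepHeight (c s) else 0

/-- The weight of a walk from height `h`; it is `0` unless the walk ends at height `0`. -/
def walkWeight (x q : R) (h : ℤ) (c : Fin n → Bool × Bool) : R :=
  (∏ t, stepWeight x q (h + heightBefore c t) (c t)) *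
    if h + ∑ s, stepHeight (c s) = 0 then 1 else 0

lemma walkWeight_cons (x q : R) (h : ℤ) (a : Bool × Bool) (c : Fin n → Bool × Bool) :
    walkWeight x q h (Fin.cons a c : Fin (n + 1) → Bool × Bool) =
      stepWeight x q h a * walkWeight x q (h + stepHeight a) c := by
  simp [walkWeight, heightBefore, Fin.prod_univ_succ, Fin.sum_univ_succ, add_assoc]

theorem sum_walkWeight (x q : R) (n h : ℕ) :
    ∑ c : Fin n → Bool × Bool, walkWeight x q h c = motzkinWeight x q n h := by
  induction n generalizing h with
  | zero => cases h <;> simp [walkWeight, motzkinWeight]; omega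
  | succ n ih =>
    rw [← (Fin.consEquiv fun _ : Fin (n + 1) => Bool × Bool).sum_comp, Fintype.sum_prod_type,
      Fintype.sum_prod_type]
    have hcons : ∀ a c, walkWeight x q h (Fin.consEquiv (fun _ : Fin (n + 1) => Bool × Bool) (a, c)) =
        stepWeight x q h a * walkWeight x q (h + stepHeight a) c :=
      fun a c => walkWeight_cons x q h a c
    simp only [hcons, ← Finset.mul_sum, Fintype.sum_bool]
    have h1 := ih (h + 1)
    have h0 := ih h
    push_cast at h1
    cases h with
    | zero =>
      simp only [Nat.cast_zero, zero_add] at h0 h1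
      simp [stepHeight, stepWeight, motzkinWeight, h0, h1]
      ring
    | succ h =>
      have h2 := ih h
      have hpos : ¬ ((h : ℤ) + 1 ≤ 0) := by omega
      have hne : ¬ ((h : ℤ) + 1 = 0) := by omega
      push_cast at h0 h1
      simp [stepHeight, stepWeight, motzkinWeight, h0, h1, h2, hpos, hne]
      ring

end Walks

/-! ### Ranks in finite sets and increasing matchings -/

section Count

variable {n : ℕ}

/-- The number of elements of `S` below `t`. -/
def countBelow (S : Finset (Fin n)) (t : ℕ) : ℕ := (S.filter fun s : Fin n => (s : ℕ) < t).card

lemma countBelow_mono (S : Finset (Fin n)) {t u : ℕ} (h : t ≤ u) :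
    countBelow S t ≤ countBelow S u :=
  Finset.card_le_card fun s => by
    simp only [Finset.mem_filter]
    exact fun ⟨h1, h2⟩ => ⟨h1, h2.trans_le h⟩

lemma countBelow_lt {S : Finset (Fin n)} {a : Fin n} {t : ℕ} (ha : a ∈ S) (h : (a : ℕ) < t) :
    countBelow S a < countBelow S t := by
  refine Finset.card_lt_card ⟨fun s => ?_, fun hs => ?_⟩
  · simp only [Finset.mem_filter]
    exact fun ⟨h1, h2⟩ => ⟨h1, h2.trans h⟩
  · have := @hs a
    simp [ha, h] at this

lemma countBelow_inj {S : Finset (Fin n)} {a b : Fin n} (ha : a ∈ S) (hb : b ∈ S)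
    (h : countBelow S a = countBelow S b) : a = b := by
  rcases lt_trichotomy a b with hab | hab | hab
  · exact absurd h (countBelow_lt ha hab).ne
  · exact hab
  · exact absurd h (countBelow_lt hb hab).ne'

lemma countBelow_lt_card {S : Finset (Fin n)} {a : Fin n} (ha : a ∈ S) :
    countBelow S a < S.card :=
  (countBelow_lt ha a.2).trans_le (Finset.card_filter_le _ _)

lemma exists_countBelow_eq {S : Finset (Fin n)} {k : ℕ} (h : k < S.card) :
    ∃ a ∈ S, countBelow S a = k := by
  have hs := Finset.surjOn_of_injOn_of_card_le (s := S) (t := Finset.range S.card)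
    (fun a => countBelow S a) (fun a ha => by simpa using countBelow_lt_card ha)
    (fun a ha b hb hab => countBelow_inj ha hb hab) (by simp)
  simpa using hs (Finset.mem_coe.2 (Finset.mem_range.2 h))

lemma countBelow_succ_of_mem {S : Finset (Fin n)} {a : Fin n} (ha : a ∈ S) :
    countBelow S (a + 1) = countBelow S a + 1 := by
  have : (S.filter fun s : Fin n => (s : ℕ) < a + 1) = insert a (S.filter fun s : Fin n => (s : ℕ) < a) := by
    ext s
    simp only [Finset.mem_filter, Finset.mem_insert, Fin.ext_iff]
    constructor
    · rintro ⟨h1, h2⟩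
      by_cases h : (s : ℕ) = a
      · exact Or.inl h
      · exact Or.inr ⟨h1, by omega⟩
    · rintro (h | h)
      · exact ⟨by rwa [Fin.ext h], by omega⟩
      · exact ⟨h.1, by omega⟩
  rw [countBelow, this, Finset.card_insert_of_notMem (by simp), countBelow]

lemma countBelow_succ_of_notMem {S : Finset (Fin n)} {a : Fin n} (ha : a ∉ S) :
    countBelow S (a + 1) = countBelow S a := by
  rw [countBelow, countBelow]
  congr 1
  refine Finset.filter_congr fun s hs => ?_
  have : (s : ℕ) ≠ a := fun h => ha (Fin.ext h ▸ hs)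
  omega

lemma countBelow_compl (S : Finset (Fin n)) {t : ℕ} (ht : t ≤ n) :
    countBelow S t + countBelow Sᶜ t = t := by
  have h1 := Finset.card_filter_add_card_filter_not (s := Finset.univ.filter fun s : Fin n => (s : ℕ) < t)
    (fun s => s ∈ S)
  have h2 : (Finset.univ.filter fun s : Fin n => (s : ℕ) < t).card = t := by
    rw [Fin.card_filter_val_lt, min_eq_right ht]
  rw [h2] at h1
  refine Eq.trans ?_ h1
  congr 1
  · rw [countBelow]; congr 1; ext s; simp [and_comm]
  · rw [countBelow]; congr 1; ext s; simp [and_comm]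

lemma countBelow_map {S : Finset (Fin n)} {π : Equiv.Perm (Fin n)} (hπ : StrictMonoOn π S)
    {i : Fin n} (hi : i ∈ S) : countBelow (S.map π.toEmbedding) (π i) = countBelow S i := by
  have : (S.map π.toEmbedding).filter (fun s : Fin n => (s : ℕ) < π i) =
      (S.filter fun s : Fin n => (s : ℕ) < i).map π.toEmbedding := by
    ext v
    simp only [Finset.mem_filter, Finset.mem_map, Equiv.coe_toEmbedding]
    constructor
    · rintro ⟨⟨s, hs, rfl⟩, h⟩
      exact ⟨s, ⟨hs, (hπ.lt_iff_lt hs hi).1 h⟩, rfl⟩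
    · rintro ⟨s, ⟨hs, h⟩, rfl⟩
      exact ⟨⟨s, hs, rfl⟩, (hπ.lt_iff_lt hs hi).2 h⟩
  rw [countBelow, this, Finset.card_map, countBelow]

/-- Two sets of the same size and their complements are matched in increasing order. -/
lemma exists_perm_countBelow_eq {S T : Finset (Fin n)} (h : S.card = T.card) :
    ∃ π : Equiv.Perm (Fin n), (∀ i, π i ∈ T ↔ i ∈ S) ∧
      (∀ i ∈ S, countBelow T (π i) = countBelow S i) ∧
      ∀ i ∉ S, countBelow Tᶜ (π i) = countBelow Sᶜ i := by
  have hc : Sᶜ.card = Tᶜ.card := by rw [Finset.card_compl, Finset.card_compl, h]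
  have hex : ∀ i, ∃ v, (v ∈ T ↔ i ∈ S) ∧ (i ∈ S → countBelow T v = countBelow S i) ∧
      (i ∉ S → countBelow Tᶜ v = countBelow Sᶜ i) := by
    intro i
    by_cases hi : i ∈ S
    · obtain ⟨v, hv, hvi⟩ := exists_countBelow_eq (h ▸ countBelow_lt_card hi)
      exact ⟨v, by simp [hv, hi], fun _ => hvi, fun h' => absurd hi h'⟩
    · obtain ⟨v, hv, hvi⟩ := exists_countBelow_eq
        (hc ▸ countBelow_lt_card (Finset.mem_compl.2 hi))
      exact ⟨v, by simp [Finset.mem_compl.1 hv, hi], fun h' => absurd h' hi, fun _ => hvi⟩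
  choose f hf1 hf2 hf3 using hex
  have hinj : Function.Injective f := by
    intro i j hij
    by_cases hi : i ∈ S
    · have hj : j ∈ S := by rwa [← hf1, ← hij, hf1]
      exact countBelow_inj hi hj (by rw [← hf2 i hi, ← hf2 j hj, hij])
    · have hj : j ∉ S := by rwa [← hf1, ← hij, hf1]
      exact countBelow_inj (Finset.mem_compl.2 hi) (Finset.mem_compl.2 hj)
        (by rw [← hf3 i hi, ← hf3 j hj, hij])
  exact ⟨Equiv.ofBijective f (Finite.injective_iff_bijective.1 hinj), hf1, hf2, hf3⟩

lemma heightBefore_eq (c : Fin n → Bool × Bool) (t : Fin n) :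
    heightBefore c t = countBelow (Finset.univ.filter fun s => (c s).1) t -
      countBelow (Finset.univ.filter fun s => (c s).2) t := by
  simp only [heightBefore, stepHeight, countBelow, Finset.filter_filter, Finset.card_filter]
  push_cast
  rw [← Finset.sum_sub_distrib]
  refine Finset.sum_congr rfl fun s _ => ?_
  by_cases h : s < t
  · have : (s : ℕ) < t := h
    simp [h]
  · have : ¬ (s : ℕ) < t := h
    simp [h]

lemma sum_stepHeight (c : Fin n → Bool × Bool) :
    ∑ s, stepHeight (c s) = (Finset.univ.filter fun s => (c s).1).card -
      ((Finset.univ.filter fun s => (c s).2).card : ℤ) := by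
  simp only [stepHeight, Finset.card_filter]
  push_cast
  rw [← Finset.sum_sub_distrib]

end Count

/-! ### 321-avoiding permutations as walks -/

section Excedances

variable {n : ℕ}

/-- The walk of a permutation: step `t` tells whether `t` is the position of an excedance and
whether it is the value of one. -/
def excedanceWalk (π : Equiv.Perm (Fin n)) (t : Fin n) : Bool × Bool :=
  (decide (t < π t), decide (π.symm t < t))

lemma heightBefore_excedanceWalk (π : Equiv.Perm (Fin n)) (t : Fin n) :
    heightBefore (excedanceWalk π) t = ∑ u, if u < t ∧ t ≤ π u then 1 else 0 := by
  have h1 : heightBefore (excedanceWalk π) t =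
      (∑ s, if s < t ∧ s < π s then 1 else 0) - ∑ s, if s < t ∧ π.symm s < s then 1 else 0 := by
    rw [← Finset.sum_sub_distrib]
    refine Finset.sum_congr rfl fun s _ => ?_
    by_cases h : s < t <;> simp [h, excedanceWalk, stepHeight]
  rw [h1, ← Equiv.sum_comp π fun s => if s < t ∧ π.symm s < s then (1 : ℤ) else 0,
    ← Finset.sum_sub_distrib]
  refine Finset.sum_congr rfl fun u _ => ?_
  simp only [Equiv.symm_apply_apply, Fin.lt_def, Fin.le_def]
  split_ifs <;> omega

lemma sum_stepHeight_excedanceWalk (π : Equiv.Perm (Fin n)) :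
    ∑ s, stepHeight (excedanceWalk π s) = 0 := by
  simp only [stepHeight, excedanceWalk, decide_eq_true_eq, Finset.sum_sub_distrib]
  rw [sub_eq_zero, ← Equiv.sum_comp π fun s => if π.symm s < s then (1 : ℤ) else 0]
  simp

/-- Pigeonhole: otherwise the positions from `i` on would all take values above `i`, which are one
too few. -/
lemma exists_gt_le_of_lt_apply (π : Equiv.Perm (Fin n)) {i : Fin n} (h : i < π i) :
    ∃ l, i < l ∧ π l ≤ i := by
  by_contra! hl
  have hsub : (Finset.Ici i).map π.toEmbedding ⊆ Finset.Ioi i := by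
    intro v hv
    simp only [Finset.mem_map, Finset.mem_Ici, Equiv.coe_toEmbedding, Finset.mem_Ioi] at hv ⊢
    obtain ⟨j, hj, rfl⟩ := hv
    rcases hj.eq_or_lt with rfl | hj
    · exact h
    · exact hl j hj
  have := Finset.card_le_card hsub
  rw [Finset.card_map, Fin.card_Ici, Fin.card_Ioi] at this
  omega

lemma exists_lt_apply_lt_of_apply_le (π : Equiv.Perm (Fin n)) {i j : Fin n} (hij : i < j)
    (hji : π j < π i) (h : π i ≤ i) : ∃ k < i, π i < π k := by
  by_contra! hk
  have hsub : (insert j (Finset.Iio i)).map π.toEmbedding ⊆ Finset.Iio (π i) := by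
    intro v hv
    simp only [Finset.mem_map, Finset.mem_insert, Finset.mem_Iio, Equiv.coe_toEmbedding] at hv ⊢
    obtain ⟨k, rfl | hki, rfl⟩ := hv
    · exact hji
    · exact lt_of_le_of_ne (hk k hki) (π.injective.ne hki.ne)
  have := Finset.card_le_card hsub
  rw [Finset.card_map, Finset.card_insert_of_notMem (by simp [hij.le]), Fin.card_Iio,
    Fin.card_Iio] at this
  rw [Fin.le_def] at h
  omega

variable {π : Equiv.Perm (Fin n)}

/-- An inversion between two excedances extends to a 321 by a later entry that is smaller than both.
-/
lemma strictMonoOn_excedances (hπ : π ∈ avoiders n pattern321) :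
    StrictMonoOn π (Finset.univ.filter fun i => i < π i) := by
  rw [mem_avoiders_321] at hπ
  intro i hi j hj hij
  simp only [Finset.coe_filter, Finset.mem_univ, true_and, Set.mem_ofPred_eq] at hi hj
  obtain ⟨l, hjl, hl⟩ := exists_gt_le_of_lt_apply π hj
  exact lt_of_le_of_ne (not_lt.1 (hπ i j l hij hjl (hl.trans_lt hj))) (π.injective.ne hij.ne)

lemma strictMonoOn_compl_excedances (hπ : π ∈ avoiders n pattern321) :
    StrictMonoOn π ((Finset.univ.filter fun i => i < π i)ᶜ : Finset (Fin n)) := by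
  rw [mem_avoiders_321] at hπ
  intro i hi j hj hij
  simp only [Finset.compl_filter, Finset.coe_filter, Finset.mem_univ, true_and, not_lt,
    Set.mem_ofPred_eq] at hi hj
  by_contra hji
  have hji := lt_of_le_of_ne (not_lt.1 hji) (π.injective.ne hij.ne')
  obtain ⟨k, hki, hk⟩ := exists_lt_apply_lt_of_apply_le π hij hji hi
  exact hπ k i j hki hij hji hk

lemma map_excedances (π : Equiv.Perm (Fin n)) :
    (Finset.univ.filter fun i => i < π i).map π.toEmbedding =
      Finset.univ.filter fun v => π.symm v < v := by
  ext v
  simp only [Finset.mem_map_equiv, Finset.mem_filter, Finset.mem_univ, true_and,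
    Equiv.apply_symm_apply]

lemma map_compl_excedances (π : Equiv.Perm (Fin n)) :
    (Finset.univ.filter fun i => i < π i)ᶜ.map π.toEmbedding =
      (Finset.univ.filter fun v => π.symm v < v)ᶜ := by
  ext v
  simp only [Finset.mem_map_equiv, Finset.mem_compl, Finset.mem_filter, Finset.mem_univ, true_and,
    Equiv.apply_symm_apply]

/-- The walk fixes both sets, and monotonicity on each class makes `π i` the value with the rank of
`i`. -/
lemma excedanceWalk_injOn :
    Set.InjOn excedanceWalk (avoiders n pattern321 : Set (Equiv.Perm (Fin n))) := by
  intro π hπ ρ hρ h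
  have hS : (Finset.univ.filter fun i => i < π i) = Finset.univ.filter fun i => i < ρ i := by
    ext t
    have := congrArg Prod.fst (congrFun h t)
    simpa [excedanceWalk] using this
  have hT : (Finset.univ.filter fun v => π.symm v < v) =
      Finset.univ.filter fun v => ρ.symm v < v := by
    ext t
    have := congrArg Prod.snd (congrFun h t)
    simpa [excedanceWalk] using this
  ext1 i
  by_cases hi : i ∈ Finset.univ.filter fun i => i < π i
  · have h1 := countBelow_map (strictMonoOn_excedances hπ) hi
    have h2 := countBelow_map (strictMonoOn_excedances hρ) (hS ▸ hi)
    have m1 := Finset.mem_map_of_mem π.toEmbedding hi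
    have m2 := Finset.mem_map_of_mem ρ.toEmbedding (hS ▸ hi)
    rw [map_excedances] at h1 h2 m1 m2
    rw [← hS, ← hT, ← h1] at h2
    rw [← hT] at m2
    exact (countBelow_inj m2 m1 h2).symm
  · have hi := Finset.mem_compl.2 hi
    have h1 := countBelow_map (strictMonoOn_compl_excedances hπ) hi
    have h2 := countBelow_map (strictMonoOn_compl_excedances hρ) (hS ▸ hi)
    have m1 := Finset.mem_map_of_mem π.toEmbedding hi
    have m2 := Finset.mem_map_of_mem ρ.toEmbedding (hS ▸ hi)
    rw [map_compl_excedances] at h1 h2 m1 m2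
    rw [← hS, ← hT, ← h1] at h2
    rw [← hT] at m2
    exact (countBelow_inj m2 m1 h2).symm

lemma walkWeight_excedanceWalk {R : Type*} [CommRing R] (x q : R)
    (hπ : π ∈ avoiders n pattern321) :
    walkWeight x q 0 (excedanceWalk π) = ∏ i, entryWeight x q ((π i : ℕ) - (i : ℕ)) := by
  rw [walkWeight, sum_stepHeight_excedanceWalk, if_pos (by simp), mul_one]
  refine Finset.prod_congr rfl fun t _ => ?_
  have hnonneg : ∀ u ∈ Finset.univ, (0 : ℤ) ≤ if u < t ∧ t ≤ π u then 1 else 0 := fun u _ => by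
    split_ifs <;> simp
  have hpos : π.symm t < t → ¬ heightBefore (excedanceWalk π) t ≤ 0 := by
    intro ht
    have := Finset.single_le_sum hnonneg (Finset.mem_univ (π.symm t))
    rw [← heightBefore_excedanceWalk, if_pos (by simp [ht])] at this
    omega
  have hzero : heightBefore (excedanceWalk π) t = 0 ↔ ∀ u, u < t → π u < t := by
    rw [heightBefore_excedanceWalk, Finset.sum_eq_zero_iff_of_nonneg hnonneg]
    simp
  have hfix : (¬ t < π t ∧ ¬ π.symm t < t ∧ heightBefore (excedanceWalk π) t = 0) ↔ π t = t := by
    rw [hzero]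
    constructor
    · rintro ⟨h1, -, h2⟩
      by_contra hne
      have hlt := lt_of_le_of_ne (not_lt.1 h1) hne
      -- If `π t < t` at height `0`, then `t + 1` positions share `t` values.
      have hsub : (Finset.Iic t).map π.toEmbedding ⊆ Finset.Iio t := by
        intro v hv
        simp only [Finset.mem_map, Finset.mem_Iic, Equiv.coe_toEmbedding, Finset.mem_Iio] at hv ⊢
        obtain ⟨u, hu, rfl⟩ := hv
        rcases hu.eq_or_lt with rfl | hu
        · exact hlt
        · exact h2 u hu
      have := Finset.card_le_card hsub
      rw [Finset.card_map, Fin.card_Iic, Fin.card_Iio] at this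
      omega
    · intro h
      refine ⟨by rw [h]; simp, by rw [← h, Equiv.symm_apply_apply]; simp [h], fun u hu => ?_⟩
      by_contra hle
      have hlt : t < π u :=
        lt_of_le_of_ne (not_lt.1 hle) fun h' => hu.ne (π.injective (h'.symm.trans h.symm))
      have hlt' : π t < π u := by rwa [h]
      -- A line passing over the fixed point `t` forces, by counting, a later entry below `t`: a 321
      -- with `t` in the middle.
      have hsub : ∃ l, t < l ∧ π l < t := by
        by_contra! hl
        have hsub : (insert u (Finset.Ici t)).map π.toEmbedding ⊆ Finset.Ici t := by
          intro v hv
          simp only [Finset.mem_map, Finset.mem_insert, Finset.mem_Ici,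
            Equiv.coe_toEmbedding] at hv ⊢
          obtain ⟨k, rfl | hk, rfl⟩ := hv
          · exact hlt.le
          · rcases hk.eq_or_lt with rfl | hk
            · exact h.ge
            · exact hl k hk
        have := Finset.card_le_card hsub
        rw [Finset.card_map, Finset.card_insert_of_notMem (by simp [hu])] at this
        omega
      obtain ⟨l, htl, hl⟩ := hsub
      exact mem_avoiders_321.1 hπ u t l hu htl (by rwa [h]) hlt'
  have e1 : (0 < ((π t : ℕ) : ℤ) - (t : ℕ)) ↔ t < π t := by rw [Fin.lt_def]; omega
  have e2 : (((π t : ℕ) : ℤ) - (t : ℕ) = 0) ↔ π t = t := by rw [Fin.ext_iff]; omega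
  simp only [stepWeight, entryWeight, e1, e2, ← hfix, zero_add]
  by_cases h1 : t < π t <;> by_cases h2 : π.symm t < t
  · simp [excedanceWalk, h1, h2, hpos h2]
  · simp [excedanceWalk, h1, h2]
  · simp [excedanceWalk, h1, h2, hpos h2]
  · simp [excedanceWalk, h1, h2]

lemma exists_excedanceWalk_eq {R : Type*} [CommRing R] {x q : R} {c : Fin n → Bool × Bool}
    (hc : walkWeight x q 0 c ≠ 0) : ∃ π ∈ avoiders n pattern321, excedanceWalk π = c := by
  set S := Finset.univ.filter fun s => (c s).1 with hS
  set T := Finset.univ.filter fun s => (c s).2 with hT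
  have hcard : S.card = T.card := by
    by_contra h
    refine hc ?_
    rw [walkWeight, sum_stepHeight, ← hS, ← hT, if_neg (by omega), mul_zero]
  have hpos : ∀ t ∈ T, countBelow T t < countBelow S t := by
    intro t ht
    by_contra h
    refine hc ?_
    rw [walkWeight, Finset.prod_eq_zero (Finset.mem_univ t), zero_mul]
    have hz : (0 : ℤ) + heightBefore c t ≤ 0 := by rw [heightBefore_eq, ← hS, ← hT]; omega
    have ht2 : (c t).2 = true := by simpa [hT] using ht
    rw [stepWeight, if_pos (c := (c t).2 = true ∧ _) ⟨ht2, hz⟩, mul_zero, zero_mul]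
  -- A closing step needs an open line, so no prefix has more closings than openings.
  have hle : ∀ t ≤ n, countBelow T t ≤ countBelow S t := by
    intro t
    induction t with
    | zero => simp [countBelow]
    | succ t ih =>
      intro ht
      have h1 : countBelow S t ≤ countBelow S (t + 1) := countBelow_mono S t.le_succ
      by_cases hm : (⟨t, ht⟩ : Fin n) ∈ T
      · have h2 := countBelow_succ_of_mem hm
        have h3 := hpos _ hm
        simp only at h2 h3
        omega
      · have h2 := countBelow_succ_of_notMem hm
        have h3 := ih (by omega)
        simp only at h2
        omega
  obtain ⟨π, hmem, hπS, hπc⟩ := exists_perm_countBelow_eq hcard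
  have hexc : ∀ i, i < π i ↔ i ∈ S := by
    intro i
    by_cases hi : i ∈ S
    -- If `π i ≤ i`, then `π i` would have rank in `T` at least its rank in `S`, against `hpos`.
    · refine iff_of_true (not_le.1 fun h => ?_) hi
      have h1 := hπS i hi
      have h2 := hpos _ ((hmem i).2 hi)
      have h3 := countBelow_mono S (Fin.le_def.1 h)
      omega
    -- If `i < π i`, then `Tᶜ` would have at most as many elements below `i + 1` as `Sᶜ` has below
    -- `i`, against `hle`.
    · refine iff_of_false (fun h => ?_) hi
      have h1 := hπc i hi
      have h2 := countBelow_compl S i.2.le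
      have h3 := countBelow_compl T (t := i + 1) i.2
      have h4 := countBelow_mono Tᶜ (t := i + 1) (u := π i) h
      have h5 := countBelow_succ_of_notMem hi
      have h6 := hle (i + 1) i.2
      omega
  have hmono : ∀ i j, (i ∈ S ↔ j ∈ S) → i < j → π i < π j := by
    intro i j hij h
    by_contra hji
    rw [not_lt, Fin.le_def] at hji
    by_cases hi : i ∈ S
    · have h1 := countBelow_lt hi (Fin.lt_def.1 h)
      rw [← hπS i hi, ← hπS j (hij.1 hi)] at h1
      exact absurd (countBelow_mono T hji) (not_le.2 h1)
    · have h1 := countBelow_lt (Finset.mem_compl.2 hi) (Fin.lt_def.1 h)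
      rw [← hπc i hi, ← hπc j (fun hj => hi (hij.2 hj))] at h1
      exact absurd (countBelow_mono Tᶜ hji) (not_le.2 h1)
  refine ⟨π, ?_, ?_⟩
  · rw [mem_avoiders_321]
    intro i j k hij hjk hkj hji
    -- The three entries of a 321 would lie in three different classes, but there are only two.
    have h1 : ¬ (i ∈ S ↔ j ∈ S) := fun h => (hmono i j h hij).not_gt hji
    have h2 : ¬ (j ∈ S ↔ k ∈ S) := fun h => (hmono j k h hjk).not_gt hkj
    have h3 : ¬ (i ∈ S ↔ k ∈ S) := fun h =>
      (hmono i k h (hij.trans hjk)).not_gt (hkj.trans hji)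
    tauto
  · funext t
    have h1 : t < π t ↔ (c t).1 = true := by rw [hexc]; simp [hS]
    have h2 : π.symm t < t ↔ (c t).2 = true := by
      have h3 := hexc (π.symm t)
      rw [← hmem, Equiv.apply_symm_apply] at h3
      rw [h3]; simp [hT]
    ext1
    · rw [excedanceWalk, Bool.eq_iff_iff, decide_eq_true_iff, h1]
    · rw [excedanceWalk, Bool.eq_iff_iff, decide_eq_true_iff, h2]

theorem sum_avoiders_321 {R : Type*} [CommRing R] (x q : R) (n : ℕ) :
    ∑ π ∈ avoiders n pattern321, ∏ i, entryWeight x q ((π i : ℕ) - (i : ℕ)) =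
      motzkinWeight x q n 0 := by
  rw [← sum_walkWeight]
  refine Finset.sum_of_injOn excedanceWalk excedanceWalk_injOn (by simp [Set.MapsTo]) ?_ ?_
  · intro c _ hc
    by_contra h
    obtain ⟨π, hπ, hπc⟩ := exists_excedanceWalk_eq h
    exact hc ⟨π, hπ, hπc⟩
  · intro π hπ
    exact (walkWeight_excedanceWalk x q hπ).symm

end Excedances

/-! ### Generating polynomials and their coefficients -/

lemma prod_entryWeight {R : Type*} [CommRing R] (x q : R) {n : ℕ} (π : Equiv.Perm (Fin n)) :
    ∏ i, entryWeight x q ((π i : ℕ) - (i : ℕ)) = x ^ fp π * q ^ exc π := by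
  rw [fp, exc, Finset.card_filter, Finset.card_filter, ← Finset.prod_pow_eq_pow_sum,
    ← Finset.prod_pow_eq_pow_sum, ← Finset.prod_mul_distrib]
  refine Finset.prod_congr rfl fun i _ => ?_
  rcases lt_trichotomy i (π i) with h | h | h
  · have h' := Fin.lt_def.1 h
    rw [entryWeight, if_pos (by omega), if_neg h.ne', if_pos h, pow_zero, pow_one, one_mul]
  · rw [entryWeight, ← h]
    simp
  · have h' := Fin.lt_def.1 h
    rw [entryWeight, if_neg (by omega), if_neg (by omega), if_neg h.ne, if_neg h.not_gt, pow_zero,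
      pow_zero, one_mul]

theorem genPoly_321_eq_genPoly_132 (n : ℕ) : genPoly n pattern321 = genPoly n pattern132 := by
  have h := (firstReturn_avoiders_132
    (entryWeight (MvPolynomial.X 0) (MvPolynomial.X 1 : MvPolynomial (Fin 2) ℤ))).eq_motzkinWeight n
  rw [← sum_avoiders_321] at h
  simp only [sub_zero, prod_entryWeight] at h
  exact h.symm

lemma coeff_genPoly (n : ℕ) {m : ℕ} (σ : Equiv.Perm (Fin m)) (i j : ℕ) :
    (genPoly n σ).coeff (Finsupp.single 0 i + Finsupp.single 1 j) =
      ((avoiders n σ).filter fun π => fp π = i ∧ exc π = j).card := by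
  rw [genPoly, MvPolynomial.coeff_sum, Finset.card_filter]
  push_cast
  refine Finset.sum_congr rfl fun π _ => ?_
  rw [MvPolynomial.X_pow_eq_monomial, MvPolynomial.X_pow_eq_monomial, MvPolynomial.monomial_mul,
    MvPolynomial.coeff_monomial, one_mul]
  refine if_congr ?_ rfl rfl
  constructor
  · intro h
    have h0 := DFunLike.congr_fun h 0
    have h1 := DFunLike.congr_fun h 1
    simp at h0 h1
    exact ⟨h0, h1⟩
  · rintro ⟨rfl, rfl⟩
    rfl

theorem theorem1 (n : ℕ) :
    (∀ i j : ℕ, i ≤ n → j ≤ n →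
      ((avoiders n pattern321).filter fun π => fp π = i ∧ exc π = j).card =
        ((avoiders n pattern132).filter fun π => fp π = i ∧ exc π = j).card) ∧
    genPoly n pattern321 = genPoly n pattern132 := by
  refine ⟨fun i j _ _ => ?_, genPoly_321_eq_genPoly_132 n⟩
  have h := coeff_genPoly n pattern321 i j
  rw [genPoly_321_eq_genPoly_132, coeff_genPoly] at h
  exact_mod_cast h.symm
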